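/- Define the Vorob'ev–Yablonski polynomials $Q_n(x)\in\mathbb{C}[x]$, $n\ge 0$, by $Q_0(x)=1$, $Q_1(x)=x$ and $$Q_{n+1}(x)\,Q_{n-1}(x)=x\,Q_n(x)^2-4\Big[Q_n''(x)\,Q_n(x)-\big(Q_n'(x)\big)^2\Big],\qquad n\ge 1,$$ and let the polynomials $\mu_k(x)$, $k\ge 0$, be defined by the generating function $$\exp\Big[-\frac{t^3}{3}+tx\Big]=\sum_{k=0}^{\infty}\mu_k(x)\,t^k .$$ Then the recursion does define a sequence of polynomials $Q_n$ (that is, each division by $Q_{n-1}$ is exact), and for every $n\ge 1$ $$Q_{n-1}(x)^2=(-1)^{\lfloor n/2\rfloor}\,\frac{1}{2^{\,n-1}}\prod_{k=1}^{n-1}\left[\frac{(2k)!}{k!}\right]^2\det\big[\mu_{\ell+j-2}(x)\big]_{\ell,j=1}^{n}.$$ -/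

import Mathlib

open Polynomial

/-- The Vorob'ev–Yablonski polynomials over `ℂ`: `Q₀ = 1`, `Q₁ = x` and
`Qₙ₊₂ Qₙ = x Qₙ₊₁² - 4 (Qₙ₊₁'' Qₙ₊₁ - (Qₙ₊₁')²)`, solved for `Qₙ₊₂` by Euclidean
division in `ℂ[X]`. (That the division leaves no remainder, so that the relation really holds,
is the predicate `IsVorobevYablonski` below.) -/
noncomputable def vorobevYablonski : ℕ → ℂ[X]
  | 0 => 1
  | 1 => X
  | n + 2 =>
      (X * vorobevYablonski (n + 1) ^ 2
        - 4 * (derivative (derivative (vorobevYablonski (n + 1))) * vorobevYablonski (n + 1)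
          - derivative (vorobevYablonski (n + 1)) ^ 2)) / vorobevYablonski n

/-- The defining differential-difference relation of the Vorob'ev–Yablonski polynomials, with its
initial values, for a sequence of complex polynomials. -/
structure IsVorobevYablonski (Q : ℕ → ℂ[X]) : Prop where
  zero : Q 0 = 1
  one : Q 1 = X
  rec_mul : ∀ n : ℕ, 1 ≤ n →
    Q (n + 1) * Q (n - 1) =
      X * Q n ^ 2 - 4 * (derivative (derivative (Q n)) * Q n - derivative (Q n) ^ 2)

/-- The generating function `exp (-t³/3 + t x)`, a formal power series in `t` (`PowerSeries.X`)
whose coefficients are complex polynomials in `x` (`Polynomial.X`): the series `-t³/3 + t x`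
substituted into the exponential series. -/
noncomputable def momentGen : PowerSeries ℂ[X] :=
  (PowerSeries.exp ℂ[X]).subst
    (-(PowerSeries.C (C (1 / 3 : ℂ)) * PowerSeries.X ^ 3)
      + PowerSeries.X * PowerSeries.C (X : ℂ[X]) : PowerSeries ℂ[X])

/-- The polynomial `μₖ(x)`: the coefficient of `tᵏ` in `exp (-t³/3 + t x)`. -/
noncomputable def moment (k : ℕ) : ℂ[X] := PowerSeries.coeff k momentGen

/-! Extend the moments by `h k = 0` for `k < 0` and write `H n s = det [h (s + i + j)]` for the
Hankel determinant of size `n`. Only three facts about `h` are used: `h k' = h (k - 1)`; `k h k = x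
h (k - 1) - h (k - 3)`; and, since the exponent is odd in `t`, the generating function satisfies
`G(t) G(-t) = 1`.

The third fact says that the Toeplitz matrix of `h` has inverse equal to itself up to signs, so
Jacobi's complementary minors give `H (n+1) 0 = ± H n 2` (`hankelDet_zero_eq_hankelDet_two`). Put `b
n = H (n+1) 0` and `a n = H (n+1) 1`. In the Desnanot–Jacobi identity this symmetry makes two terms
equal, whence `a n ^ 2 = ± 2 b n b (n+1)` (`intMoment_hankel_sq`). Plücker relations, combined with
the first two facts, give the Toda-type equation that expresses `(2k+3) a k a (k+1)` through `b = b
(k+1)` as `± (x b² - 2 (b'' b - b'²))` (`intMoment_hankel_toda`).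

If `b = β Q²`, then `log b = 2 log Q + const`, so the 2 in the Toda expression becomes the 4 of the
recursion for `Q`. By induction `b n` and `a n` are explicit constants times `Q n ^ 2` and `Q (n+1)
Q n`; divisibility is read off from the same two identities (`hankelDet_intMoment_eq`). -/

/-! ### Plücker relations for determinants with two free rows. -/

section Brackets

variable {R : Type*} [CommRing R]

/-- The determinant of the square matrix with rows `u`, `v` followed by the rows of `M`. -/
def bracket {k : ℕ} (M : Fin k → Fin (k + 2) → R) (u v : Fin (k + 2) → R) : R :=
  Matrix.det (Matrix.of (Fin.cons u (Fin.cons v M : Fin (k + 1) → Fin (k + 2) → R) :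
    Fin (k + 2) → Fin (k + 2) → R))

lemma bracket_swap {k : ℕ} (M : Fin k → Fin (k + 2) → R) (u v : Fin (k + 2) → R) :
    bracket M u v = -bracket M v u := by
  have h : (Matrix.of (Fin.cons u (Fin.cons v M : Fin (k + 1) → Fin (k + 2) → R) :
      Fin (k + 2) → Fin (k + 2) → R)) =
      (Matrix.of (Fin.cons v (Fin.cons u M : Fin (k + 1) → Fin (k + 2) → R) :
        Fin (k + 2) → Fin (k + 2) → R)).submatrix (Equiv.swap 0 1) id := by
    ext i j
    refine Fin.cases ?_ (fun i => Fin.cases ?_ (fun i => ?_) i) i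
    · simp only [Matrix.submatrix_apply, Equiv.swap_apply_left, Matrix.of_apply, id]; rfl
    · have : (Fin.succ 0 : Fin (k + 2)) = 1 := rfl
      simp only [Matrix.submatrix_apply, this, Equiv.swap_apply_right, Matrix.of_apply, id]; rfl
    · have hs : Equiv.swap (0 : Fin (k + 2)) 1 i.succ.succ = i.succ.succ :=
        Equiv.swap_apply_of_ne_of_ne (Fin.succ_ne_zero _)
          (fun h => Fin.succ_ne_zero i (Fin.succ_injective _ h))
      simp only [Matrix.submatrix_apply, hs, Matrix.of_apply, id]
      rfl
  unfold bracket
  rw [h, Matrix.det_permute, Equiv.Perm.sign_swap (by simp)]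
  simp

/-- The three-term Plücker relation. -/
lemma bracket_mul_bracket {k : ℕ} (M : Fin k → Fin (k + 2) → R) (a b c d : Fin (k + 2) → R) :
    bracket M a b * bracket M c d =
      bracket M a c * bracket M b d + bracket M a d * bracket M c b := by
  let A : Matrix (Fin (k + 2)) (Fin (k + 2)) R :=
    Matrix.of (Fin.cons c (Fin.cons d M : Fin (k + 1) → Fin (k + 2) → R))
  let L : (Fin (k + 2) → R) →ₗ[R] R :=
    (Matrix.detRowAlternating (R := R) (n := Fin (k + 2))).toMultilinearMap.toLinearMap
      (Fin.cons a (Fin.cons 0 M : Fin (k + 1) → Fin (k + 2) → R)) 1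
  have hL : ∀ v, L v = bracket M a v := by
    intro v
    change Matrix.det _ = Matrix.det _
    congr 1
    have : (1 : Fin (k + 2)) = Fin.succ 0 := rfl
    rw [this, ← Fin.cons_update, Fin.update_cons_zero]
    rfl
  -- Cramer's rule expands `b` in the rows `c, d, M`; pairing with `a` through `L` kills the rows of
  -- `M`.
  have hvec : A.det • b = ∑ i, (A.updateRow i b).det • A i := by
    have := Matrix.mulVec_cramer A.transpose b
    rw [Matrix.det_transpose] at this
    rw [← this]
    ext j
    simp only [Matrix.mulVec, dotProduct, Matrix.cramer_transpose_apply, Finset.sum_apply,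
      Pi.smul_apply, Matrix.transpose_apply, smul_eq_mul]
    exact Finset.sum_congr rfl fun i _ => mul_comm _ _
  have h1 := congrArg L hvec
  rw [map_smul, map_sum, Fin.sum_univ_succ, Fin.sum_univ_succ] at h1
  simp only [map_smul, smul_eq_mul] at h1
  simp only [hL] at h1
  have hz : ∀ i : Fin k, bracket M a (A i.succ.succ) = 0 := by
    intro i
    refine Matrix.det_zero_of_row_eq (i := 1) (j := i.succ.succ)
      (fun h => Fin.succ_ne_zero i (Fin.succ_injective _ h.symm)) ?_
    rfl
  have h0 : (A.updateRow 0 b).det = bracket M b d := by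
    unfold bracket
    congr 1
    change Function.update (Fin.cons c (Fin.cons d M : Fin (k + 1) → Fin (k + 2) → R) :
      Fin (k + 2) → Fin (k + 2) → R) 0 b = _
    rw [Fin.update_cons_zero]
    rfl
  have h2 : (A.updateRow (Fin.succ 0) b).det = bracket M c b := by
    unfold bracket
    congr 1
    change Function.update (Fin.cons c (Fin.cons d M : Fin (k + 1) → Fin (k + 2) → R) :
      Fin (k + 2) → Fin (k + 2) → R) (Fin.succ 0) b = _
    rw [← Fin.cons_update, Fin.update_cons_zero]
    rfl
  rw [h0, h2] at h1
  simp only [hz, mul_zero, Finset.sum_const_zero, add_zero] at h1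
  change bracket M c d * bracket M a b = bracket M b d * bracket M a c +
    bracket M c b * bracket M a d at h1
  linear_combination h1

lemma det_cons_single {n : ℕ} (l : Fin (n + 1)) (M : Fin n → Fin (n + 1) → R) :
    Matrix.det (Matrix.of (Fin.cons (Pi.single l 1) M : Fin (n + 1) → Fin (n + 1) → R)) =
      (-1) ^ (l : ℕ) * Matrix.det (Matrix.of fun i j => M i (l.succAbove j)) := by
  rw [Matrix.det_succ_row_zero, Finset.sum_eq_single l]
  · simp only [Matrix.of_apply, Fin.cons_zero, Pi.single_eq_same, mul_one]
    rfl
  · intro j _ hj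
    simp [Pi.single_eq_of_ne hj]
  · simp

lemma det_snoc {n : ℕ} (M : Fin n → Fin (n + 1) → R) (u : Fin (n + 1) → R) :
    Matrix.det (Matrix.of (Fin.snoc M u : Fin (n + 1) → Fin (n + 1) → R)) =
      (-1) ^ n * Matrix.det (Matrix.of (Fin.cons u M : Fin (n + 1) → Fin (n + 1) → R)) := by
  have : (Matrix.of (Fin.snoc M u : Fin (n + 1) → Fin (n + 1) → R)) =
      (Matrix.of (Fin.cons u M : Fin (n + 1) → Fin (n + 1) → R)).submatrix
        (finRotate (n + 1)) id := by
    rw [Fin.snoc_eq_cons_rotate]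
    rfl
  rw [this, Matrix.det_permute, sign_finRotate]
  simp

end Brackets

/-! ### Determinants whose rows are windows of one sequence. -/

section ShiftDet

variable {R : Type*} [CommRing R] (h : ℤ → R)

/-- The determinant with rows `h (a i), h (a i + 1), …`. -/
def shiftDet {n : ℕ} (a : Fin n → ℤ) : R := Matrix.det (Matrix.of fun i j : Fin n => h (a i + j))

/-- The window of length `n` of the sequence `h` starting at `p`. -/
def window (n : ℕ) (p : ℤ) : Fin n → R := fun j => h (p + j)

lemma shiftDet_eq_zero {n : ℕ} {a : Fin n → ℤ} {i j : Fin n} (hij : i ≠ j) (haij : a i = a j) :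
    shiftDet h a = 0 :=
  Matrix.det_zero_of_row_eq hij (by ext k; simp [haij])

lemma shiftDet_snoc {n : ℕ} (a : Fin n → ℤ) (p : ℤ) :
    shiftDet h (Fin.snoc a p : Fin (n + 1) → ℤ) =
      (-1) ^ n * shiftDet h (Fin.cons p a : Fin (n + 1) → ℤ) := by
  have h1 := det_snoc (fun i => window h (n + 1) (a i)) (window h (n + 1) p)
  convert h1 using 2
  · unfold shiftDet
    congr 1
    ext i j
    refine Fin.lastCases ?_ (fun i => ?_) i <;> simp [window]
  · unfold shiftDet
    congr 1
    ext i j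
    refine Fin.cases ?_ (fun i => ?_) i <;> simp [window]

lemma shiftDet_cons_cons {k : ℕ} (a : Fin k → ℤ) (p q : ℤ) :
    shiftDet h (Fin.cons p (Fin.cons q a : Fin (k + 1) → ℤ) : Fin (k + 2) → ℤ) =
      bracket (fun i => window h (k + 2) (a i)) (window h (k + 2) p) (window h (k + 2) q) := by
  unfold shiftDet bracket
  congr 1
  ext i j
  refine Fin.cases ?_ (fun i => Fin.cases ?_ (fun i => ?_) i) i <;> simp [window]

lemma shiftDet_cons_cons_swap {k : ℕ} (a : Fin k → ℤ) (p q : ℤ) :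
    shiftDet h (Fin.cons p (Fin.cons q a : Fin (k + 1) → ℤ) : Fin (k + 2) → ℤ) =
      -shiftDet h (Fin.cons q (Fin.cons p a : Fin (k + 1) → ℤ) : Fin (k + 2) → ℤ) := by
  rw [shiftDet_cons_cons, shiftDet_cons_cons, bracket_swap]

lemma shiftDet_cons_snoc {k : ℕ} (a : Fin k → ℤ) (p q : ℤ) :
    shiftDet h (Fin.cons p (Fin.snoc a q : Fin (k + 1) → ℤ) : Fin (k + 2) → ℤ) =
      (-1) ^ k * shiftDet h (Fin.cons p (Fin.cons q a : Fin (k + 1) → ℤ) : Fin (k + 2) → ℤ) := by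
  rw [Fin.cons_snoc_eq_snoc_cons, shiftDet_snoc, shiftDet_cons_cons_swap]
  ring

lemma shiftDet_snoc_snoc {k : ℕ} (a : Fin k → ℤ) (p q : ℤ) :
    shiftDet h (Fin.snoc (Fin.snoc a p : Fin (k + 1) → ℤ) q : Fin (k + 2) → ℤ) =
      shiftDet h (Fin.cons p (Fin.cons q a : Fin (k + 1) → ℤ) : Fin (k + 2) → ℤ) := by
  rw [shiftDet_snoc, shiftDet_cons_snoc, shiftDet_cons_cons_swap, pow_succ]
  have : ((-1 : R) ^ k) * (-1) ^ k = 1 := by rw [← mul_pow]; simp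
  linear_combination (shiftDet h (Fin.cons p (Fin.cons q a : Fin (k + 1) → ℤ) : Fin (k + 2) → ℤ))
    * this

/-- A unit vector as a row deletes a column; losing column 0 moves every window one step to the
right. -/
lemma bracket_window_single_zero {k : ℕ} (a : Fin k → ℤ) (p : ℤ) :
    bracket (fun i => window h (k + 2) (a i)) (window h (k + 2) p) (Pi.single 0 1) =
      -shiftDet h (Fin.cons (p + 1) (fun i => a i + 1) : Fin (k + 1) → ℤ) := by
  rw [bracket_swap, bracket, det_cons_single]
  unfold shiftDet
  simp only [Fin.val_zero, pow_zero, one_mul]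
  congr 2
  ext i j
  refine Fin.cases ?_ (fun i => ?_) i <;> simp [window] <;> ring_nf

lemma bracket_window_single_last {k : ℕ} (a : Fin k → ℤ) (p : ℤ) :
    bracket (fun i => window h (k + 2) (a i)) (window h (k + 2) p) (Pi.single (Fin.last _) 1) =
      (-1) ^ k * shiftDet h (Fin.cons p a : Fin (k + 1) → ℤ) := by
  rw [bracket_swap, bracket, det_cons_single]
  unfold shiftDet
  rw [Fin.val_last, pow_succ]
  rw [show ∀ x : R, -((-1) ^ k * -1 * x) = (-1) ^ k * x by intro x; ring]
  congr 2
  ext i j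
  refine Fin.cases ?_ (fun i => ?_) i <;> simp [window]

lemma bracket_single_zero_single_last {k : ℕ} (a : Fin k → ℤ) :
    bracket (fun i => window h (k + 2) (a i)) (Pi.single 0 1) (Pi.single (Fin.last _) 1) =
      (-1) ^ k * shiftDet h (fun i => a i + 1) := by
  rw [bracket, det_cons_single]
  have := det_cons_single (Fin.last k) (fun (i : Fin k) (j : Fin (k + 1)) =>
    window h (k + 2) (a i) j.succ)
  simp only [Fin.val_zero, pow_zero, one_mul]
  rw [Fin.val_last] at this
  convert this using 2
  · ext i j
    refine Fin.cases ?_ (fun i => ?_) i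
    · simp [Pi.single_apply, ← Fin.succ_last]
    · simp
  · unfold shiftDet
    congr 1
    ext i j
    simp [window]
    ring_nf

end ShiftDet

/-! ### Bilinear identities for Hankel determinants. -/

section Hankel

variable {R : Type*} [CommRing R] (h : ℤ → R)

/-- The Hankel determinant `det [h (s + i + j)]` of size `n`. -/
def hankelDet (n : ℕ) (s : ℤ) : R := shiftDet h fun i : Fin n => s + i

/-- The Hankel determinant of size `n + 1` with its last row raised by one step. -/
def lastRaised (n : ℕ) (s : ℤ) : R :=
  shiftDet h (Fin.snoc (fun i : Fin n => s + i) (s + n + 1) : Fin (n + 1) → ℤ)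

/-- The Hankel determinant of size `n + 1` with its first row lowered by `d` steps. -/
def firstLowered (d : ℤ) (n : ℕ) (s : ℤ) : R :=
  shiftDet h (Fin.cons (s - d) (fun i : Fin n => s + 1 + i) : Fin (n + 1) → ℤ)

/-- The Hankel determinant of size `n + 2` with its first two rows lowered by one step. -/
def twoLowered (n : ℕ) (s : ℤ) : R :=
  shiftDet h (Fin.cons (s - 1) (Fin.cons s (fun i : Fin n => s + 2 + i) : Fin (n + 1) → ℤ) :
    Fin (n + 2) → ℤ)

lemma shift_eq_cons (n : ℕ) (s : ℤ) :
    (fun i : Fin (n + 1) => s + i) = (Fin.cons s fun i : Fin n => s + 1 + i : Fin (n + 1) → ℤ) := by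
  ext i
  refine Fin.cases ?_ (fun i => ?_) i
  · simp
  · simp; ring

lemma shift_eq_snoc (n : ℕ) (s : ℤ) :
    (fun i : Fin (n + 1) => s + i) = (Fin.snoc (fun i : Fin n => s + i) (s + n) :
      Fin (n + 1) → ℤ) := by
  ext i
  refine Fin.lastCases ?_ (fun i => ?_) i <;> simp

lemma hankelDet_succ_eq_firstLowered (n : ℕ) (s : ℤ) :
    hankelDet h (n + 1) s = firstLowered h 0 n s := by
  rw [hankelDet, firstLowered, shift_eq_cons, sub_zero]

lemma neg_one_pow_mul_self (k : ℕ) : ((-1 : R) ^ k) * (-1) ^ k = 1 := by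
  rw [← mul_pow]; simp

lemma shift_add_one (n : ℕ) (s : ℤ) :
    (fun i : Fin n => s + i + 1) = fun i : Fin n => s + 1 + (i : ℤ) := by
  ext i; ring

/-- The middle rows of a Hankel determinant together with the first and the last one. -/
lemma hankelDet_eq_bracket (k : ℕ) (s : ℤ) :
    hankelDet h (k + 2) s = (-1) ^ k * bracket (fun i : Fin k => window h (k + 2) (s + 1 + i))
      (window h (k + 2) s) (window h (k + 2) (s + 1 + k)) := by
  rw [← shiftDet_cons_cons, ← shiftDet_cons_snoc, ← shift_eq_snoc, ← shift_eq_cons, hankelDet]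

/-- The Desnanot–Jacobi identity for Hankel determinants. -/
lemma hankelDet_mul_hankelDet (k : ℕ) (s : ℤ) :
    hankelDet h (k + 2) s * hankelDet h k (s + 2) =
      hankelDet h (k + 1) s * hankelDet h (k + 1) (s + 2) - hankelDet h (k + 1) (s + 1) ^ 2 := by
  have P := bracket_mul_bracket (fun i : Fin k => window h (k + 2) (s + 1 + i))
    (window h (k + 2) s) (window h (k + 2) (s + 1 + k)) (Pi.single 0 1) (Pi.single (Fin.last _) 1)
  rw [bracket_swap _ (Pi.single 0 1) (window _ _ _)] at P
  rw [bracket_window_single_zero, bracket_window_single_zero, bracket_window_single_last,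
    bracket_window_single_last, bracket_single_zero_single_last] at P
  have h1 : shiftDet h (fun i : Fin k => s + 1 + i + 1) = hankelDet h k (s + 2) := by
    rw [hankelDet, shift_add_one]; ring_nf
  have h2 : shiftDet h (Fin.cons (s + 1) fun i : Fin k => s + 1 + i + 1 : Fin (k + 1) → ℤ) =
      hankelDet h (k + 1) (s + 1) := by
    rw [hankelDet, shift_eq_cons, shift_add_one]
  have h3 : shiftDet h (Fin.cons (s + 1 + k) fun i : Fin k => s + 1 + i : Fin (k + 1) → ℤ) =
      (-1) ^ k * hankelDet h (k + 1) (s + 1) := by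
    rw [hankelDet, shift_eq_snoc, shiftDet_snoc, ← mul_assoc, neg_one_pow_mul_self, one_mul]
  have h4 : shiftDet h (Fin.cons s fun i : Fin k => s + 1 + i : Fin (k + 1) → ℤ) =
      hankelDet h (k + 1) s := by
    rw [hankelDet, shift_eq_cons]
  have h5 : shiftDet h (Fin.cons (s + 1 + k + 1) fun i : Fin k => s + 1 + i + 1 :
      Fin (k + 1) → ℤ) = (-1) ^ k * hankelDet h (k + 1) (s + 2) := by
    rw [hankelDet, shift_eq_snoc, shiftDet_snoc, ← mul_assoc, neg_one_pow_mul_self, one_mul,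
      shift_add_one]
    ring_nf
  rw [h1, h2, h3, h4, h5] at P
  rw [hankelDet_eq_bracket]
  have e := neg_one_pow_mul_self (R := R) k
  linear_combination P + (hankelDet h (k + 1) s * hankelDet h (k + 1) (s + 2)
    - hankelDet h (k + 1) (s + 1) ^ 2) * e

/-- Plücker relation for the windows at `s`, `s + 1 + k`, `s + k + 2` and the first unit vector. At
`s = 0` the left side is the product in the Toda equation. -/
lemma hankelDet_mul_hankelDet_succ (k : ℕ) (s : ℤ) :
    hankelDet h (k + 1) (s + 1) * hankelDet h (k + 2) (s + 1) =
      lastRaised h (k + 1) s * hankelDet h (k + 1) (s + 2)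
        - hankelDet h (k + 2) s * lastRaised h k (s + 2) := by
  have P := bracket_mul_bracket (fun i : Fin k => window h (k + 2) (s + 1 + i))
    (window h (k + 2) s) (window h (k + 2) (s + 1 + k)) (window h (k + 2) (s + 1 + k + 1))
    (Pi.single 0 1)
  rw [bracket_swap _ (window _ _ (s + 1 + k + 1)) (window _ _ (s + 1 + k))] at P
  rw [bracket_window_single_zero, bracket_window_single_zero, bracket_window_single_zero] at P
  have h1 : shiftDet h (Fin.cons (s + 1) fun i : Fin k => s + 1 + i + 1 : Fin (k + 1) → ℤ) =
      hankelDet h (k + 1) (s + 1) := by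
    rw [hankelDet, shift_eq_cons, shift_add_one]
  have h2 : shiftDet h (Fin.cons (s + 1 + k + 1) fun i : Fin k => s + 1 + i + 1 :
      Fin (k + 1) → ℤ) = (-1) ^ k * hankelDet h (k + 1) (s + 2) := by
    rw [hankelDet, shift_eq_snoc, shiftDet_snoc, ← mul_assoc, neg_one_pow_mul_self, one_mul,
      shift_add_one]
    ring_nf
  have h3 : shiftDet h (Fin.cons (s + 1 + k + 1 + 1) fun i : Fin k => s + 1 + i + 1 :
      Fin (k + 1) → ℤ) = (-1) ^ k * lastRaised h k (s + 2) := by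
    rw [lastRaised, shiftDet_snoc, ← mul_assoc, neg_one_pow_mul_self, one_mul,
      shift_add_one]
    ring_nf
  have h4 : bracket (fun i : Fin k => window h (k + 2) (s + 1 + i))
      (window h (k + 2) (s + 1 + k)) (window h (k + 2) (s + 1 + k + 1)) =
      hankelDet h (k + 2) (s + 1) := by
    rw [← shiftDet_cons_cons, ← shiftDet_snoc_snoc, hankelDet, shift_eq_snoc, shift_eq_snoc]
    push_cast
    ring_nf
  have h5 : lastRaised h (k + 1) s = (-1) ^ k *
      bracket (fun i : Fin k => window h (k + 2) (s + 1 + i))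
      (window h (k + 2) s) (window h (k + 2) (s + 1 + k + 1)) := by
    rw [← shiftDet_cons_cons, ← shiftDet_cons_snoc, lastRaised, shift_eq_cons,
      Fin.cons_snoc_eq_snoc_cons]
    push_cast
    ring_nf
  rw [h1, h2, h3, h4] at P
  rw [hankelDet_eq_bracket h k s, h5]
  linear_combination -P

/-- Plücker relation for the windows at `s - 1`, `s + 1`, `s` and the first unit vector. When `h k'
= h (k - 1)`, the left side is a product of two derivatives of Hankel determinants. -/
lemma firstLowered_mul_firstLowered (k : ℕ) (s : ℤ) :
    firstLowered h 1 (k + 1) s * firstLowered h 1 k (s + 2) =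
      twoLowered h k s * hankelDet h (k + 1) (s + 2)
        + firstLowered h 2 k (s + 2) * hankelDet h (k + 2) s := by
  have P := bracket_mul_bracket (fun i : Fin k => window h (k + 2) (s + 2 + i))
    (window h (k + 2) (s - 1)) (window h (k + 2) (s + 1)) (window h (k + 2) s)
    (Pi.single 0 1)
  rw [bracket_window_single_zero, bracket_window_single_zero, bracket_window_single_zero,
    ← shiftDet_cons_cons, ← shiftDet_cons_cons, ← shiftDet_cons_cons] at P
  have e : s + 1 + 1 = s + 2 := by ring
  have h1 : firstLowered h 1 (k + 1) s = shiftDet h (Fin.cons (s - 1)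
      (Fin.cons (s + 1) fun i : Fin k => s + 2 + i : Fin (k + 1) → ℤ) : Fin (k + 2) → ℤ) := by
    rw [firstLowered, shift_eq_cons, e]
  have h2 : hankelDet h (k + 2) s = shiftDet h (Fin.cons s
      (Fin.cons (s + 1) fun i : Fin k => s + 2 + i : Fin (k + 1) → ℤ) : Fin (k + 2) → ℤ) := by
    rw [hankelDet, shift_eq_cons, shift_eq_cons, e]
  have h3 : ∀ d : ℤ, firstLowered h d k (s + 2) =
      shiftDet h (Fin.cons (s + 2 - d) fun i : Fin k => s + 2 + i + 1 : Fin (k + 1) → ℤ) := by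
    intro d
    rw [firstLowered, shift_add_one]
  rw [hankelDet_succ_eq_firstLowered h k, h3, h3, h3, h1, h2, twoLowered]
  ring_nf at P ⊢
  linear_combination -P

end Hankel

/-! ### Differentiating determinants row by row. -/

section Derivative

variable {R : Type*} [CommRing R]

/-- Both sums are the trace of `adj(A) B`, the derivative of `det` at `A` in the direction `B`. -/
lemma sum_det_updateRow_eq_sum_det_updateCol {n : ℕ} (A B : Matrix (Fin n) (Fin n) R) :
    ∑ i, (A.updateRow i (B i)).det = ∑ j, (A.updateCol j fun i => B i j).det := by
  have h1 : ∀ i, (A.updateRow i (B i)).det = ∑ j, A.adjugate j i * B i j := by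
    intro i
    rw [← Matrix.cramer_transpose_apply, Matrix.cramer_eq_adjugate_mulVec,
      ← Matrix.adjugate_transpose]
    rfl
  have h2 : ∀ j, (A.updateCol j fun i => B i j).det = ∑ i, A.adjugate j i * B i j := by
    intro j
    rw [← Matrix.cramer_apply, Matrix.cramer_eq_adjugate_mulVec]
    rfl
  simp only [h1, h2]
  exact Finset.sum_comm

lemma derivative_det {n : ℕ} (A : Matrix (Fin n) (Fin n) R[X]) :
    derivative A.det = ∑ i, (A.updateRow i fun j => derivative (A i j)).det := by
  rw [sum_det_updateRow_eq_sum_det_updateCol A (fun i j => derivative (A i j)), Matrix.det_apply,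
    derivative_sum]
  simp only [Matrix.det_apply]
  rw [Finset.sum_comm]
  refine Finset.sum_congr rfl fun σ _ => ?_
  rw [← Finset.smul_sum, Units.smul_def, Units.smul_def, zsmul_eq_mul, zsmul_eq_mul,
    derivative_intCast_mul, derivative_prod_finset]
  congr 1
  refine Finset.sum_congr rfl fun j _ => ?_
  rw [← Finset.mul_prod_erase _ _ (Finset.mem_univ j), mul_comm]
  congr 1
  · simp
  · refine Finset.prod_congr rfl fun l hl => ?_
    rw [Matrix.updateCol_ne (Finset.ne_of_mem_erase hl)]

lemma det_updateRow_window {n : ℕ} (h : ℤ → R) (a : Fin n → ℤ) (i : Fin n) (p : ℤ) :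
    (Matrix.updateRow (Matrix.of fun i j : Fin n => h (a i + j)) i fun j => h (p + j)).det =
      shiftDet h (Function.update a i p) := by
  unfold shiftDet
  congr 1
  ext l j
  by_cases hl : l = i
  · subst hl; simp
  · simp [hl]

lemma derivative_shiftDet {n : ℕ} {h : ℤ → R[X]} (hd : ∀ k, derivative (h k) = h (k - 1))
    (a : Fin n → ℤ) :
    derivative (shiftDet h a) = ∑ i, shiftDet h (Function.update a i (a i - 1)) := by
  rw [shiftDet, derivative_det]
  refine Finset.sum_congr rfl fun i _ => ?_
  rw [← det_updateRow_window]
  congr 2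
  ext j
  simp only [Matrix.of_apply, hd]
  ring_nf

end Derivative

/-! ### Lowering rows of Hankel determinants, and their derivatives. -/

section Lowering

variable {R : Type*} [CommRing R] (h : ℤ → R)

lemma shiftDet_update_eq_zero {n : ℕ} (a : Fin n → ℤ) {i j : Fin n} (hij : j ≠ i) {p : ℤ}
    (hp : a j = p) : shiftDet h (Function.update a i p) = 0 :=
  shiftDet_eq_zero h hij (by simp [hij, hp])

/-- The sum of the determinants obtained by lowering one row of a Hankel determinant by two. -/
def sumLoweredTwo (n : ℕ) (s : ℤ) : R :=
  ∑ i : Fin n, shiftDet h (Function.update (fun i : Fin n => s + i) i (s + i - 2))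

lemma sumLoweredTwo_one (s : ℤ) : sumLoweredTwo h 1 s = firstLowered h 2 0 s := by
  simp only [sumLoweredTwo, Fin.sum_univ_one, firstLowered]
  congr 1
  ext i
  simp [Fin.eq_zero i]

lemma update_shift_succ (n : ℕ) (s p : ℤ) (i : Fin n) :
    Function.update (fun i : Fin (n + 1) => s + i) i.succ p =
      Fin.cons s (Function.update (fun i : Fin n => s + 1 + i) i p) := by
  rw [shift_eq_cons, Fin.cons_update]

lemma update_shift_zero (n : ℕ) (s p : ℤ) :
    Function.update (fun i : Fin (n + 1) => s + i) 0 p =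
      Fin.cons p (fun i : Fin n => s + 1 + i) := by
  rw [shift_eq_cons, Fin.update_cons_zero]

/-- Lowering row `i ≥ 2` by two repeats row `i - 2`. Lowering row 1 puts it just below row 0, and
sorting the two costs a sign. -/
lemma sumLoweredTwo_add_two (k : ℕ) (s : ℤ) :
    sumLoweredTwo h (k + 2) s = firstLowered h 2 (k + 1) s - twoLowered h k s := by
  rw [sumLoweredTwo, Fin.sum_univ_succ, Fin.sum_univ_succ, Finset.sum_eq_zero, add_zero,
    update_shift_zero, update_shift_succ, update_shift_zero, shiftDet_cons_cons_swap]
  · simp only [firstLowered, twoLowered, Fin.val_zero, Fin.val_succ]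
    ring_nf
  · intro i _
    refine shiftDet_update_eq_zero h _ (j := i.castSucc.castSucc) ?_ ?_
    · simp only [ne_eq, Fin.ext_iff, Fin.val_castSucc, Fin.val_succ]; omega
    · simp; ring

end Lowering

section Derivative

variable {R : Type*} [CommRing R] {h : ℤ → R[X]} (hd : ∀ k, derivative (h k) = h (k - 1))
include hd

lemma derivative_hankelDet_succ (n : ℕ) (s : ℤ) :
    derivative (hankelDet h (n + 1) s) = firstLowered h 1 n s := by
  rw [hankelDet, derivative_shiftDet hd, Fin.sum_univ_succ, Finset.sum_eq_zero, add_zero,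
    update_shift_zero, firstLowered]
  · simp
  · intro i _
    refine shiftDet_update_eq_zero h _ (j := i.castSucc) ?_ ?_
    · simp [Fin.ext_iff]
    · simp; ring

lemma derivative_firstLowered_zero (s : ℤ) :
    derivative (firstLowered h 1 0 s) = firstLowered h 2 0 s := by
  rw [firstLowered, derivative_shiftDet hd, Fin.sum_univ_one, firstLowered, Fin.update_cons_zero]
  simp only [Fin.cons_zero]
  ring_nf

lemma derivative_firstLowered_succ (k : ℕ) (s : ℤ) :
    derivative (firstLowered h 1 (k + 1) s) = firstLowered h 2 (k + 1) s + twoLowered h k s := by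
  rw [firstLowered, derivative_shiftDet hd, Fin.sum_univ_succ, Fin.sum_univ_succ,
    Finset.sum_eq_zero, add_zero, Fin.update_cons_zero, ← Fin.cons_update, update_shift_zero]
  · simp only [firstLowered, twoLowered, Fin.cons_zero, Fin.cons_succ, Fin.val_zero]
    push_cast
    ring_nf
  · intro i _
    refine shiftDet_update_eq_zero h _ (j := i.castSucc.succ) ?_ ?_
    · simp [Fin.ext_iff]
    · simp; ring

/-- The sum is the difference, and the second derivative the sum, of the same two determinants, so
either one can be eliminated. The Toda equation needs both eliminations, here and in
`sumLoweredTwo_add_two_eq`. -/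
lemma sumLoweredTwo_succ_eq (n : ℕ) (s : ℤ) :
    sumLoweredTwo h (n + 1) s =
      2 * firstLowered h 2 n s - derivative (derivative (hankelDet h (n + 1) s)) := by
  rw [derivative_hankelDet_succ hd]
  cases n with
  | zero => rw [sumLoweredTwo_one, derivative_firstLowered_zero hd]; ring
  | succ k => rw [sumLoweredTwo_add_two, derivative_firstLowered_succ hd]; ring

lemma sumLoweredTwo_add_two_eq (k : ℕ) (s : ℤ) :
    sumLoweredTwo h (k + 2) s =
      derivative (derivative (hankelDet h (k + 2) s)) - 2 * twoLowered h k s := by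
  rw [derivative_hankelDet_succ hd, sumLoweredTwo_add_two, derivative_firstLowered_succ hd]
  ring

end Derivative

/-! ### The three-term recurrence at the level of Hankel determinants. -/

section String

variable {R : Type*} [CommRing R] (h : ℤ → R)

lemma sum_mul_shiftDet_raise (n : ℕ) (s : ℤ) (w : Fin (n + 1) → R) :
    ∑ i : Fin (n + 1), w i *
        shiftDet h (Function.update (fun i : Fin (n + 1) => s + i) i (s + i + 1)) =
      w (Fin.last n) * lastRaised h n s := by
  rw [Fin.sum_univ_castSucc, Finset.sum_eq_zero, zero_add, lastRaised]
  · rw [shift_eq_snoc, Fin.update_snoc_last]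
    rfl
  · intro i _
    rw [shiftDet_update_eq_zero h _ (j := i.succ), mul_zero]
    · simp [Fin.ext_iff]
    · simp; ring

variable {h} (x : R) (hr : ∀ k : ℤ, (k : R) * h k = x * h (k - 1) - h (k - 3))
include hr

/-- Apply the recurrence at index `s + i + j + 1` to each row in turn and sum. The index multiplier
varies with both `i` and `j`, so it is split as `i + (s + 1 + j)`: the first part weights rows, the
second weights columns, and of each weighted sum only the last term survives, giving `n + (s + 1 +
n)`. -/
lemma mul_lastRaised (n : ℕ) (s : ℤ) :
    ((2 * n + 1 + s : ℤ) : R) * lastRaised h n s =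
      (n + 1) * (x * hankelDet h (n + 1) s) - sumLoweredTwo h (n + 1) s := by
  set A : Matrix (Fin (n + 1)) (Fin (n + 1)) R := Matrix.of fun i j => h (s + i + j) with hA
  have hAdet : hankelDet h (n + 1) s = A.det := rfl
  have hAt : A.transpose = A := by
    ext i j
    simp only [hA, Matrix.transpose_apply, Matrix.of_apply]
    ring_nf
  have hrow : ∀ (i : Fin (n + 1)) (p : ℤ), (A.updateRow i fun j => h (p + j)).det =
      shiftDet h (Function.update (fun i : Fin (n + 1) => s + i) i p) :=
    fun i p => det_updateRow_window h _ i p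
  have hcol : ∀ (j : Fin (n + 1)) (p : ℤ), (A.updateCol j fun i => h (p + i)).det =
      shiftDet h (Function.update (fun i : Fin (n + 1) => s + i) j p) := by
    intro j p
    rw [← hrow, ← Matrix.det_transpose, ← Matrix.updateRow_transpose, hAt]
  let B₁ : Matrix (Fin (n + 1)) (Fin (n + 1)) R := Matrix.of fun i j =>
    ((i : ℕ) : R) * h (s + i + 1 + j)
  let B₂ : Matrix (Fin (n + 1)) (Fin (n + 1)) R := Matrix.of fun i j =>
    (s + 1 + (j : ℕ) : R) * h (s + j + 1 + i)
  have e₁ : ∑ i, (A.updateRow i (B₁ i)).det = n * lastRaised h n s := by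
    have : ∀ i, (A.updateRow i (B₁ i)).det = ((i : ℕ) : R) *
        shiftDet h (Function.update (fun i : Fin (n + 1) => s + i) i (s + i + 1)) := by
      intro i
      rw [← hrow, ← Matrix.det_updateRow_smul]
      rfl
    simp only [this]
    rw [sum_mul_shiftDet_raise h n s fun i => ((i : ℕ) : R), Fin.val_last]
  have e₂ : ∑ i, (A.updateRow i (B₂ i)).det = (s + 1 + n) * lastRaised h n s := by
    have : ∀ j, (A.updateCol j fun i => B₂ i j).det = (s + 1 + (j : ℕ) : R) *
        shiftDet h (Function.update (fun i : Fin (n + 1) => s + i) j (s + j + 1)) := by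
      intro j
      rw [← hcol, ← Matrix.det_updateCol_smul]
      rfl
    rw [sum_det_updateRow_eq_sum_det_updateCol]
    simp only [this]
    rw [sum_mul_shiftDet_raise h n s fun i => (s + 1 + (i : ℕ) : R), Fin.val_last]
  have e₃ : ∀ i, (A.updateRow i (B₁ i)).det + (A.updateRow i (B₂ i)).det = x * A.det -
      shiftDet h (Function.update (fun i : Fin (n + 1) => s + i) i (s + i - 2)) := by
    intro i
    rw [← hrow, ← Matrix.det_updateRow_add]
    have hv : B₁ i + B₂ i = x • A i + (-1 : R) • fun j : Fin (n + 1) => h (s + i - 2 + j) := by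
      ext j
      have := hr (s + i + j + 1)
      push_cast at this
      simp only [Pi.add_apply, Pi.smul_apply, smul_eq_mul, B₁, B₂, hA, Matrix.of_apply]
      rw [show s + (i : ℤ) + 1 + j = s + i + j + 1 by ring,
        show s + (j : ℤ) + 1 + i = s + i + j + 1 by ring,
        show s + (i : ℤ) - 2 + j = s + i + j + 1 - 3 by ring,
        show s + (i : ℤ) + j = s + i + j + 1 - 1 by ring]
      rw [show s + (i : ℤ) + j + 1 - 1 + 1 = s + i + j + 1 by ring]
      linear_combination this
    rw [hv, Matrix.det_updateRow_add, Matrix.det_updateRow_smul, Matrix.det_updateRow_smul,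
      Matrix.updateRow_eq_self]
    ring
  have e₄ := Finset.sum_congr (rfl : (Finset.univ : Finset (Fin (n + 1))) = _) fun i _ => e₃ i
  rw [Finset.sum_add_distrib, e₁, e₂, Finset.sum_sub_distrib, Finset.sum_const, Finset.card_univ,
    Fintype.card_fin, nsmul_eq_mul] at e₄
  rw [hAdet, sumLoweredTwo]
  push_cast at e₄ ⊢
  linear_combination e₄

end String

/-! ### The Toda-type equation. -/

section Toda

variable {R : Type*} [CommRing R] {h : ℤ → R[X]} (hd : ∀ k, derivative (h k) = h (k - 1))
  (hr : ∀ k : ℤ, (k : R[X]) * h k = X * h (k - 1) - h (k - 3))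
include hd hr

/-- If `b = det [h (i + j)]` of size `k + 2` equals, up to the sign `e`, the determinant of size
`k + 1` starting at index `2`, then the adjacent odd Hankel determinants are given by a
Toda-type expression in `b`. -/
lemma hankelDet_one_mul_hankelDet_one (k : ℕ) (e : R)
    (he : e * e = 1) (hsymm : hankelDet h (k + 2) 0 = C e * hankelDet h (k + 1) 2) :
    (2 * (k : R[X]) + 3) * (hankelDet h (k + 1) 1 * hankelDet h (k + 2) 1) =
      C e * (X * hankelDet h (k + 2) 0 ^ 2 -
        2 * (derivative (derivative (hankelDet h (k + 2) 0)) * hankelDet h (k + 2) 0 -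
          derivative (hankelDet h (k + 2) 0) ^ 2)) := by
  have heC : (C e : R[X]) * C e = 1 := by rw [← C_mul, he, C_1]
  have h2 := hankelDet_mul_hankelDet_succ h k 0
  have h3 := firstLowered_mul_firstLowered h k 0
  have hT := mul_lastRaised X hr (k + 1) 0
  have hT' := mul_lastRaised X hr k 2
  rw [sumLoweredTwo_add_two_eq hd] at hT
  rw [sumLoweredTwo_succ_eq hd] at hT'
  rw [← derivative_hankelDet_succ hd, ← derivative_hankelDet_succ hd] at h3
  simp only [zero_add] at h2 h3
  have hb : hankelDet h (k + 1) 2 = C e * hankelDet h (k + 2) 0 := by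
    rw [hsymm, ← mul_assoc, heC, one_mul]
  rw [hb] at h2 h3 hT'
  simp only [derivative_C_mul] at h3 hT'
  push_cast at hT hT'
  set b := hankelDet h (k + 2) 0
  -- `hT` and `hT'` carry the same factor `2k + 3`, and their `X`-terms have weights `k + 2` and `k
  -- + 1`, which leaves one `X b²`; `h3` turns the remaining lowered determinants into `b'²`.
  linear_combination (2 * (k : R[X]) + 3) * h2 + C e * b * hT - b * hT' - 2 * h3

end Toda

/-! ### Complementary minors and the symmetry between offsets 0 and 2. -/

section Symmetry

lemma sign_revPerm_succ (n : ℕ) :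
    Equiv.Perm.sign (Fin.revPerm : Equiv.Perm (Fin (n + 1))) =
      (-1) ^ n * Equiv.Perm.sign (Fin.revPerm : Equiv.Perm (Fin n)) := by
  have h : (Fin.revPerm : Equiv.Perm (Fin (n + 1))) =
      Equiv.Perm.decomposeFin.symm (0, (Fin.revPerm : Equiv.Perm (Fin n))) * finRotate (n + 1) := by
    ext i
    refine Fin.lastCases ?_ (fun i => ?_) i
    · simp
    · have : finRotate (n + 1) i.castSucc = i.succ := by
        rw [finRotate_apply, Fin.coeSucc_eq_succ]
      rw [Equiv.Perm.mul_apply, this]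
      simp [Fin.rev_castSucc]
  rw [h, map_mul, sign_finRotate, Equiv.Perm.decomposeFin.symm_sign]
  simp [mul_comm]

lemma val_finRotate_pow (N m : ℕ) (i : Fin (N + 1)) :
    (((finRotate (N + 1)) ^ m) i : ℕ) = (i + m) % (N + 1) := by
  induction m with
  | zero => simp [Nat.mod_eq_of_lt i.isLt]
  | succ m ih =>
    rw [pow_succ', Equiv.Perm.mul_apply, finRotate_apply, Fin.val_add, ih, Fin.val_one',
      ← Nat.add_mod, add_assoc]

variable {R : Type*} [CommRing R] {h : ℤ → R}

lemma det_rev_rows (n : ℕ) (f : Fin n → Fin n → R) :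
    Matrix.det (Matrix.of fun i j => f i.rev j) =
      ((Equiv.Perm.sign (Fin.revPerm : Equiv.Perm (Fin n)) : ℤ) : R) *
        Matrix.det (Matrix.of f) :=
  Matrix.det_permute Fin.revPerm (Matrix.of f)

variable (h0 : h 0 = 1) (hneg : ∀ k < 0, h k = 0)
  (hconv : ∀ m : ℕ, ∑ j ∈ Finset.range (m + 1), h (m - j) * ((-1) ^ j * h j) =
    if m = 0 then 1 else 0)

include hneg hconv in
lemma sum_mul_alternating (N r r' : ℕ) (hr : r < N) :
    ∑ c ∈ Finset.range N, h (r - c) * ((-1) ^ (c + r') * h (c - r')) =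
      if r = r' then 1 else 0 := by
  rcases lt_or_ge r r' with hlt | hle
  · rw [if_neg hlt.ne]
    refine Finset.sum_eq_zero fun c _ => ?_
    rcases lt_or_ge r c with hc | hc
    · rw [hneg _ (by omega), zero_mul]
    · rw [hneg (c - r') (by omega), mul_zero, mul_zero]
  · obtain ⟨m, rfl⟩ := Nat.exists_eq_add_of_le hle
    have hsub : Finset.Ico r' (r' + m + 1) ⊆ Finset.range N := by
      intro c hc
      rw [Finset.mem_Ico] at hc
      rw [Finset.mem_range]
      omega
    rw [← Finset.sum_subset hsub, Finset.sum_Ico_eq_sum_range]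
    · rw [show r' + m + 1 - r' = m + 1 by omega]
      have := hconv m
      simp only [add_eq_left]
      rw [← this]
      refine Finset.sum_congr rfl fun j _ => ?_
      push_cast
      rw [show (r' : ℤ) + m - (r' + j) = m - j by ring, show (r' : ℤ) + j - r' = j by ring,
        show r' + j + r' = j + 2 * r' by ring, pow_add, pow_mul]
      simp
    · intro c _ hc
      rw [Finset.mem_Ico] at hc
      rcases lt_or_ge c r' with hc' | hc'
      · rw [hneg (c - r') (by omega), mul_zero, mul_zero]
      · rw [hneg _ (by push_cast; omega), zero_mul]

include h0 hneg in
lemma det_lowerToeplitz (N : ℕ) : Matrix.det (Matrix.of fun i j : Fin N => h (i - j)) = 1 := by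
  rw [Matrix.det_of_isLowerTriangular]
  · simp [h0]
  · intro i j hij
    have : (i : ℕ) < j := hij
    exact hneg _ (by omega)

include h0 hneg hconv in
/-- Complementary minors of the lower triangular Toeplitz matrix of `h` and of its inverse. -/
lemma det_toeplitz_eq_det_toeplitz (n : ℕ) :
    Matrix.det (Matrix.of fun i j : Fin (n + 1) => h (n + i - j)) =
      Matrix.det (Matrix.of fun i j : Fin n => h (n + 1 + i - j)) := by
  -- Rows are rotated by `n` so that the wanted minor of the Toeplitz matrix is the upper left block
  -- and the complementary minor of its inverse is the lower right one.
  let row : Fin (n + 1) ⊕ Fin n → ℕ := Sum.elim (fun i => n + i) (fun i => i)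
  let col : Fin (n + 1) ⊕ Fin n → ℕ := fun c => (finSumFinEquiv c : Fin (n + 1 + n))
  let L : Matrix (Fin (n + 1) ⊕ Fin n) (Fin (n + 1) ⊕ Fin n) R :=
    Matrix.of fun r c => h (row r - col c)
  let K : Matrix (Fin (n + 1) ⊕ Fin n) (Fin (n + 1) ⊕ Fin n) R :=
    Matrix.of fun c r => (-1) ^ (col c + row r) * h (col c - row r)
  have hrow_lt : ∀ r, row r < n + 1 + n := by
    rintro (i | i) <;> simp only [row, Sum.elim_inl, Sum.elim_inr] <;> omega
  have hrow_inj : Function.Injective row := by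
    rintro (i | i) (j | j) hij <;> simp only [row, Sum.elim_inl, Sum.elim_inr] at hij
    · congr 1; ext; omega
    · omega
    · omega
    · congr 1; ext; omega
  have hLK : L * K = 1 := by
    ext r r'
    rw [Matrix.mul_apply, Matrix.one_apply]
    have h1 := sum_mul_alternating hneg hconv (n + 1 + n) (row r) (row r') (hrow_lt r)
    rw [Finset.sum_range, ← Equiv.sum_comp finSumFinEquiv] at h1
    simp only [hrow_inj.eq_iff] at h1
    exact h1
  have hL : L.det = 1 := by
    have : L = ((Matrix.of fun i j : Fin (n + 1 + n) => h (i - j)).submatrix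
        ((finRotate (n + 1 + n)) ^ n) id).submatrix finSumFinEquiv finSumFinEquiv := by
      ext r c
      have hr : (((finRotate (n + 1 + n)) ^ n) (finSumFinEquiv r) : ℕ) = row r := by
        have e : n + 1 + n = n + n + 1 := by ring
        have : ∀ (M : ℕ) (hM : M = n + n + 1) (i : Fin M),
            (((finRotate M) ^ n) i : ℕ) = (i + n) % M := by
          rintro M rfl i
          exact val_finRotate_pow _ _ _
        rw [this _ e]
        rcases r with i | i
        · simp only [finSumFinEquiv_apply_left, Fin.val_castAdd, row, Sum.elim_inl]
          rw [Nat.mod_eq_of_lt (by omega), add_comm]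
        · simp only [finSumFinEquiv_apply_right, Fin.val_natAdd, row, Sum.elim_inr]
          rw [show n + 1 + (i : ℕ) + n = i + (n + 1 + n) by ring, Nat.add_mod_right,
            Nat.mod_eq_of_lt (by omega)]
      simp only [L, Matrix.of_apply, Matrix.submatrix_apply, id, hr, col]
    -- A rotation of `2n + 1` points is an even permutation.
    rw [this, Matrix.det_submatrix_equiv_self, Matrix.det_permute, map_pow, sign_finRotate,
      det_lowerToeplitz h0 hneg, show n + 1 + n - 1 = n + n by omega]
    simp [← two_mul]
  -- Jacobi's argument: only the second block column of `L * K = 1` is used, and determinants then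
  -- give `det K₂₂ = det L₁₁`.
  have hblock : L * Matrix.fromBlocks 1 K.toBlocks₁₂ 0 K.toBlocks₂₂ =
      Matrix.fromBlocks L.toBlocks₁₁ 0 L.toBlocks₂₁ 1 := by
    have h1 := hLK
    rw [← Matrix.fromBlocks_toBlocks L, ← Matrix.fromBlocks_toBlocks K,
      Matrix.fromBlocks_multiply, ← Matrix.fromBlocks_one, Matrix.fromBlocks_inj] at h1
    conv_lhs => rw [← Matrix.fromBlocks_toBlocks L]
    rw [Matrix.fromBlocks_multiply, h1.2.1, h1.2.2.2]
    simp
  have hdet := congrArg Matrix.det hblock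
  rw [Matrix.det_mul, hL, Matrix.det_fromBlocks_zero₂₁, Matrix.det_fromBlocks_zero₁₂,
    Matrix.det_one, Matrix.det_one, one_mul, one_mul, mul_one] at hdet
  have hL₁₁ : L.toBlocks₁₁ = Matrix.of fun i j : Fin (n + 1) => h (n + i - j) := by
    ext i j
    simp [L, Matrix.toBlocks₁₁, row, col]
  have hK₂₂ : K.toBlocks₂₂ = Matrix.of fun i j : Fin n => (-1) ^ (n + 1 + (i : ℕ)) *
      (Matrix.of fun i j : Fin n => (-1) ^ (j : ℕ) *
        (Matrix.of fun i j : Fin n => h (n + 1 + i - j)) i j) i j := by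
    ext i j
    simp only [K, Matrix.toBlocks₂₂, row, col, Matrix.of_apply, Sum.elim_inr,
      finSumFinEquiv_apply_right, Fin.val_natAdd]
    push_cast
    ring
  rw [hL₁₁, hK₂₂, Matrix.det_mul_column, Matrix.det_mul_row, ← mul_assoc,
    ← Finset.prod_mul_distrib] at hdet
  rw [← hdet, Finset.prod_congr rfl (g := fun _ => (-1 : R) ^ (n + 1))]
  · rw [Finset.prod_const, Finset.card_univ, Fintype.card_fin, ← pow_mul,
      Even.neg_one_pow (by rw [mul_comm]; exact Nat.even_mul_succ_self n), one_mul]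
  · intro i _
    rw [← pow_add, add_assoc, pow_add, ← two_mul, pow_mul _ 2]
    simp

-- Reversing the rows turns Hankel into Toeplitz matrices; the reversals of `n + 1` and of `n` rows
-- differ in sign by `(-1) ^ n`.
include h0 hneg hconv in
lemma hankelDet_zero_eq_hankelDet_two (n : ℕ) :
    hankelDet h (n + 1) 0 = (-1) ^ n * hankelDet h n 2 := by
  have h1 : hankelDet h (n + 1) 0 =
      ((Equiv.Perm.sign (Fin.revPerm : Equiv.Perm (Fin (n + 1))) : ℤ) : R) *
      Matrix.det (Matrix.of fun i j : Fin (n + 1) => h (n + i - j)) := by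
    rw [← Matrix.det_transpose (Matrix.of fun i j : Fin (n + 1) => h (n + i - j))]
    have := det_rev_rows (n + 1) fun i j : Fin (n + 1) => h (n + j - i)
    refine Eq.trans ?_ this
    unfold hankelDet shiftDet
    congr 1
    ext i j
    simp only [Matrix.of_apply, Fin.val_rev]
    congr 1
    have := i.isLt
    omega
  have h2 : hankelDet h n 2 = ((Equiv.Perm.sign (Fin.revPerm : Equiv.Perm (Fin n)) : ℤ) : R) *
      Matrix.det (Matrix.of fun i j : Fin n => h (n + 1 + i - j)) := by
    rw [← Matrix.det_transpose (Matrix.of fun i j : Fin n => h (n + 1 + i - j))]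
    have := det_rev_rows n fun i j : Fin n => h (n + 1 + j - i)
    refine Eq.trans ?_ this
    unfold hankelDet shiftDet
    congr 1
    ext i j
    simp only [Matrix.of_apply, Fin.val_rev]
    congr 1
    have := i.isLt
    omega
  rw [h1, h2, det_toeplitz_eq_det_toeplitz h0 hneg hconv, sign_revPerm_succ]
  push_cast
  ring

end Symmetry

/-! ### The three properties of the moments. -/

section Moments

lemma hasSubst_momentExponent :
    PowerSeries.HasSubst (-(PowerSeries.C (C (1 / 3 : ℂ)) * PowerSeries.X ^ 3)
      + PowerSeries.X * PowerSeries.C (X : ℂ[X]) : PowerSeries ℂ[X]) := by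
  refine PowerSeries.HasSubst.of_constantCoeff_zero' ?_
  simp

lemma derivative_momentGen :
    PowerSeries.derivative ℂ[X] momentGen =
      momentGen * (PowerSeries.C (X : ℂ[X]) - PowerSeries.X ^ 2) := by
  rw [momentGen, PowerSeries.derivative_subst hasSubst_momentExponent, PowerSeries.derivative_exp]
  congr 1
  have h3 : (PowerSeries.C (C (1 / 3 : ℂ)) : PowerSeries ℂ[X]) * 3 = 1 := by
    have h : (PowerSeries.C (C (3 : ℂ)) : PowerSeries ℂ[X]) = 3 := by
      rw [map_ofNat, map_ofNat]
    rw [← h, ← map_mul, ← map_mul]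
    norm_num
  simp only [map_add, map_neg, Derivation.leibniz, PowerSeries.derivative_C,
    PowerSeries.derivative_X, PowerSeries.derivative_pow, smul_eq_mul, mul_zero, add_zero, zero_add,
    mul_one]
  push_cast
  linear_combination (-PowerSeries.X ^ 2) * h3

lemma constantCoeff_momentExponent :
    PowerSeries.constantCoeff (-(PowerSeries.C (C (1 / 3 : ℂ)) * PowerSeries.X ^ 3)
      + PowerSeries.X * PowerSeries.C (X : ℂ[X]) : PowerSeries ℂ[X]) = 0 := by
  simp

lemma constantCoeff_momentGen : PowerSeries.constantCoeff momentGen = 1 := by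
  have h1 := PowerSeries.constantCoeff_subst_eq_zero
    (a := (-(PowerSeries.C (C (1 / 3 : ℂ)) * PowerSeries.X ^ 3)
      + PowerSeries.X * PowerSeries.C (X : ℂ[X]) : PowerSeries ℂ[X])) constantCoeff_momentExponent
    (PowerSeries.exp ℂ[X] - 1) (by simp)
  have h2 : (PowerSeries.exp ℂ[X]).subst (-(PowerSeries.C (C (1 / 3 : ℂ)) * PowerSeries.X ^ 3)
      + PowerSeries.X * PowerSeries.C (X : ℂ[X]) : PowerSeries ℂ[X]) =
      (PowerSeries.exp ℂ[X] - 1).subst (-(PowerSeries.C (C (1 / 3 : ℂ)) * PowerSeries.X ^ 3)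
      + PowerSeries.X * PowerSeries.C (X : ℂ[X]) : PowerSeries ℂ[X]) + 1 := by
    have h3 : PowerSeries.exp ℂ[X] = (PowerSeries.exp ℂ[X] - 1) + 1 := by ring
    conv_lhs => rw [h3]
    rw [PowerSeries.subst_add hasSubst_momentExponent]
    congr 1
    rw [← PowerSeries.coe_substAlgHom hasSubst_momentExponent, map_one]
  rw [momentGen, h2, map_add, map_one]
  rw [PowerSeries.constantCoeff, h1, zero_add]

lemma moment_zero : moment 0 = 1 := by
  rw [moment, PowerSeries.coeff_zero_eq_constantCoeff, constantCoeff_momentGen]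

/-- The moments, extended by zero to negative indices. -/
noncomputable def intMoment (k : ℤ) : ℂ[X] := if k < 0 then 0 else moment k.toNat

lemma intMoment_of_neg (k : ℤ) (hk : k < 0) : intMoment k = 0 := if_pos hk

lemma intMoment_natCast (k : ℕ) : intMoment k = moment k := by
  rw [intMoment, if_neg (by omega), Int.toNat_natCast]

lemma intMoment_zero : intMoment 0 = 1 := by
  rw [← moment_zero]; exact intMoment_natCast 0

/-- Coefficients of `G_t = (x - t²) G`; the extension by zero makes it valid for every integer. -/
lemma intMoment_recurrence (k : ℤ) :
    (k : ℂ[X]) * intMoment k = X * intMoment (k - 1) - intMoment (k - 3) := by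
  rcases lt_trichotomy k 0 with hk | rfl | hk
  · rw [intMoment_of_neg k hk, intMoment_of_neg _ (by omega), intMoment_of_neg _ (by omega)]
    simp
  · rw [intMoment_of_neg (0 - 1) (by omega), intMoment_of_neg (0 - 3) (by omega)]
    simp
  · obtain ⟨n, rfl⟩ : ∃ n : ℕ, k = n + 1 := ⟨(k - 1).toNat, by omega⟩
    have h1 := congrArg (PowerSeries.coeff n) derivative_momentGen
    rw [PowerSeries.coeff_derivative, mul_sub, map_sub, PowerSeries.coeff_mul_C,
      PowerSeries.coeff_mul_X_pow'] at h1
    have h2 : intMoment ((n : ℤ) + 1 - 3) =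
        if 2 ≤ n then PowerSeries.coeff (n - 2) momentGen else 0 := by
      split_ifs with hn
      · rw [show (n : ℤ) + 1 - 3 = ((n - 2 : ℕ) : ℤ) by omega, intMoment_natCast, moment]
      · exact intMoment_of_neg _ (by omega)
    rw [h2, show (n : ℤ) + 1 - 1 = n by ring, intMoment_natCast, moment,
      show (n : ℤ) + 1 = ((n + 1 : ℕ) : ℤ) by push_cast; ring, intMoment_natCast, moment]
    push_cast
    linear_combination h1

lemma derivative_intMoment (k : ℤ) : derivative (intMoment k) = intMoment (k - 1) := by
  rcases lt_or_ge k 0 with hk | hk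
  · rw [intMoment_of_neg k hk, intMoment_of_neg _ (by omega), derivative_zero]
  · obtain ⟨n, rfl⟩ := Int.eq_ofNat_of_zero_le hk
    induction n using Nat.strong_induction_on with
    | _ n ih =>
      have ih' : ∀ j : ℤ, j < n → derivative (intMoment j) = intMoment (j - 1) := by
        intro j hj
        rcases lt_or_ge j 0 with hj0 | hj0
        · rw [intMoment_of_neg j hj0, intMoment_of_neg _ (by omega), derivative_zero]
        · obtain ⟨m, rfl⟩ := Int.eq_ofNat_of_zero_le hj0
          exact ih m (by omega) (by omega)
      rcases Nat.eq_zero_or_pos n with rfl | hn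
      · simp only [Nat.cast_zero]
        rw [intMoment_zero, intMoment_of_neg _ (by omega), derivative_one]
      · have h1 := congrArg derivative (intMoment_recurrence n)
        rw [derivative_intCast_mul, derivative_sub, derivative_mul, derivative_X,
          ih' (n - 1) (by omega), ih' (n - 3) (by omega)] at h1
        have h2 := intMoment_recurrence (n - 1)
        have hne : ((n : ℤ) : ℂ[X]) ≠ 0 := by exact_mod_cast hn.ne'
        refine mul_left_cancel₀ hne ?_
        rw [show (n : ℤ) - 3 - 1 = n - 1 - 3 by ring] at h1
        push_cast at h1 h2 ⊢
        -- The differentiated recurrence at `n` minus the recurrence at `n - 1` leaves `n h n' = n h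
        -- (n - 1)`.
        linear_combination h1 - h2

lemma PowerSeries.derivative_mul_eq {R : Type*} [CommRing R] (f g : PowerSeries R) :
    PowerSeries.derivative R (f * g) =
      f * PowerSeries.derivative R g + g * PowerSeries.derivative R f := by
  rw [Derivation.leibniz, smul_eq_mul, smul_eq_mul]

/-- The exponent is odd in `t`. Formally, the product has zero `t`-derivative and constant term 1.
-/
lemma momentGen_mul_evalNegHom : momentGen * PowerSeries.evalNegHom momentGen = 1 := by
  have hneg : PowerSeries.derivative ℂ[X] (PowerSeries.evalNegHom momentGen) =
      -(PowerSeries.evalNegHom momentGen * (PowerSeries.C (X : ℂ[X]) - PowerSeries.X ^ 2)) := by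
    have h1 : ∀ f : PowerSeries ℂ[X], PowerSeries.derivative ℂ[X] (PowerSeries.evalNegHom f) =
        -PowerSeries.evalNegHom (PowerSeries.derivative ℂ[X] f) := by
      intro f
      ext1 n
      simp only [PowerSeries.evalNegHom, PowerSeries.coeff_derivative, PowerSeries.coeff_rescale,
        map_neg]
      ring
    rw [h1, derivative_momentGen, map_mul, map_sub, map_pow, PowerSeries.evalNegHom_X]
    have h2 : PowerSeries.evalNegHom (PowerSeries.C (X : ℂ[X])) = PowerSeries.C (X : ℂ[X]) := by
      ext1 n
      rcases n with _ | n <;>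
        simp [PowerSeries.evalNegHom, PowerSeries.coeff_rescale, PowerSeries.coeff_C]
    rw [h2]
    ring
  refine PowerSeries.derivative.ext (R := ℂ[X]) ?_ ?_
  · rw [PowerSeries.derivative_mul_eq, hneg, derivative_momentGen, PowerSeries.derivative_one]
    ring
  · rw [map_mul, constantCoeff_momentGen, map_one, one_mul,
      ← PowerSeries.coeff_zero_eq_constantCoeff_apply, PowerSeries.evalNegHom,
      PowerSeries.coeff_rescale, PowerSeries.coeff_zero_eq_constantCoeff, constantCoeff_momentGen]
    simp

lemma sum_intMoment_mul_alternating (m : ℕ) :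
    ∑ j ∈ Finset.range (m + 1), intMoment (m - j) * ((-1) ^ j * intMoment j) =
      if m = 0 then 1 else 0 := by
  have h1 := congrArg (PowerSeries.coeff m) momentGen_mul_evalNegHom
  rw [mul_comm, PowerSeries.coeff_mul, Finset.Nat.sum_antidiagonal_eq_sum_range_succ_mk,
    PowerSeries.coeff_one] at h1
  rw [← h1]
  refine Finset.sum_congr rfl fun j hj => ?_
  rw [Finset.mem_range] at hj
  rw [show (m : ℤ) - j = ((m - j : ℕ) : ℤ) by omega, intMoment_natCast, intMoment_natCast, moment,
    moment, PowerSeries.evalNegHom, PowerSeries.coeff_rescale]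
  ring

end Moments

/-! ### The right-hand side of the recursion. -/

section Recursion

/-- The right-hand side of the recursion of the Vorob'ev–Yablonski polynomials. -/
noncomputable def recursionNumerator (v : ℂ[X]) : ℂ[X] :=
  X * v ^ 2 - 4 * (derivative (derivative v) * v - derivative v ^ 2)

/-- By degrees: `X v²` has degree `2 deg v + 1`, the bracket at most `2 deg v`. This keeps every `Q
n` nonzero, so that it can be cancelled. -/
lemma recursionNumerator_ne_zero {v : ℂ[X]} (hv : v ≠ 0) : recursionNumerator v ≠ 0 := by
  intro h
  have h1 : X * v ^ 2 = 4 * (derivative (derivative v) * v - derivative v ^ 2) :=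
    sub_eq_zero.mp h
  have h2 : (X * v ^ 2).natDegree = 2 * v.natDegree + 1 := by
    rw [natDegree_X_mul (pow_ne_zero 2 hv), natDegree_pow]
  have hd := natDegree_derivative_le v
  have hdd := natDegree_derivative_le (derivative v)
  have h3 : (4 * (derivative (derivative v) * v - derivative v ^ 2)).natDegree ≤
      2 * v.natDegree := by
    rw [show (4 : ℂ[X]) = C 4 from (map_ofNat C 4).symm]
    refine (natDegree_C_mul_le _ _).trans ((natDegree_sub_le _ _).trans (max_le ?_ ?_))
    · refine natDegree_mul_le.trans ?_
      omega
    · refine natDegree_pow_le.trans ?_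
      omega
  rw [← h1, h2] at h3
  omega

lemma recursionNumerator_of_eq {b v : ℂ[X]} {β : ℂ} (hb : b = C β * v ^ 2) :
    X * b ^ 2 - 2 * (derivative (derivative b) * b - derivative b ^ 2) =
      C (β ^ 2) * v ^ 2 * recursionNumerator v := by
  subst hb
  rw [recursionNumerator, C_pow, sq v]
  simp only [derivative_mul, derivative_C, zero_mul, zero_add, derivative_add]
  ring

end Recursion

/-! ### Normalising constants and the induction. -/

section Induction

lemma intMoment_hankel_symm (n : ℕ) :
    hankelDet intMoment (n + 1) 0 = (-1) ^ n * hankelDet intMoment n 2 :=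
  hankelDet_zero_eq_hankelDet_two intMoment_zero intMoment_of_neg sum_intMoment_mul_alternating n

lemma intMoment_hankel_sq (n : ℕ) :
    hankelDet intMoment (n + 1) 1 ^ 2 =
      2 * (-1) ^ (n + 1) * hankelDet intMoment (n + 2) 0 * hankelDet intMoment (n + 1) 0 := by
  have h1 := hankelDet_mul_hankelDet intMoment n 0
  have h2 := intMoment_hankel_symm n
  have h3 := intMoment_hankel_symm (n + 1)
  have e := neg_one_pow_mul_self (R := ℂ[X]) n
  simp only [zero_add] at h1
  rw [pow_succ] at h3 ⊢
  linear_combination h1 + hankelDet intMoment (n + 2) 0 * (-1) ^ n * h2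
    + hankelDet intMoment (n + 1) 0 * (-1) ^ n * h3
    + (hankelDet intMoment (n + 2) 0 * hankelDet intMoment n 2
      - hankelDet intMoment (n + 1) 0 * hankelDet intMoment (n + 1) 2) * e

lemma intMoment_hankel_toda (k : ℕ) :
    (2 * (k : ℂ[X]) + 3) * (hankelDet intMoment (k + 1) 1 * hankelDet intMoment (k + 2) 1) =
      (-1) ^ (k + 1) * (X * hankelDet intMoment (k + 2) 0 ^ 2 -
        2 * (derivative (derivative (hankelDet intMoment (k + 2) 0)) * hankelDet intMoment (k + 2) 0
          - derivative (hankelDet intMoment (k + 2) 0) ^ 2)) := by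
  have h := hankelDet_one_mul_hankelDet_one derivative_intMoment intMoment_recurrence k
    ((-1 : ℂ) ^ (k + 1)) (neg_one_pow_mul_self _)
    (by rw [intMoment_hankel_symm]; simp)
  rw [h]
  simp

/-- The product of the normalising factors `(2k)! / k!`. -/
noncomputable def factorialRatioProd (n : ℕ) : ℂ :=
  ∏ k ∈ Finset.Icc 1 n, ((2 * k).factorial : ℂ) / (k.factorial : ℂ)

lemma factorialRatioProd_ne_zero (n : ℕ) : factorialRatioProd n ≠ 0 :=
  Finset.prod_ne_zero_iff.mpr fun _ _ => div_ne_zero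
    (Nat.cast_ne_zero.mpr (Nat.factorial_ne_zero _)) (Nat.cast_ne_zero.mpr (Nat.factorial_ne_zero _))

lemma factorialRatioProd_succ (n : ℕ) :
    factorialRatioProd (n + 1) =
      factorialRatioProd n * (((2 * (n + 1)).factorial : ℂ) / ((n + 1).factorial : ℂ)) := by
  rw [factorialRatioProd, Finset.prod_Icc_succ_top (by omega), factorialRatioProd]

/-- Consecutive factors `(2k)!/k!` have ratio `2 (2k - 1)`; this is how the normalisation absorbs
the `2k + 3` of the Toda equation. -/
lemma factorialRatioProd_mul (n : ℕ) :
    factorialRatioProd n * factorialRatioProd (n + 2) =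
      2 * (2 * n + 3) * factorialRatioProd (n + 1) ^ 2 := by
  have h : ((2 * (n + 2)).factorial : ℂ) / ((n + 2).factorial : ℂ) =
      2 * (2 * n + 3) * (((2 * (n + 1)).factorial : ℂ) / ((n + 1).factorial : ℂ)) := by
    have h1 : ((n + 1).factorial : ℂ) ≠ 0 := Nat.cast_ne_zero.mpr (Nat.factorial_ne_zero _)
    have h2 : (n : ℂ) + 2 ≠ 0 := by exact_mod_cast Nat.succ_ne_zero (n + 1)
    rw [show 2 * (n + 2) = 2 * (n + 1) + 1 + 1 by ring, Nat.factorial_succ, Nat.factorial_succ,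
      Nat.factorial_succ (n + 1)]
    push_cast
    rw [show (n : ℂ) + 1 + 1 = n + 2 by ring]
    field_simp
    ring
  rw [factorialRatioProd_succ (n + 1), h, factorialRatioProd_succ n]
  ring

lemma neg_one_pow_half_mul_succ (n : ℕ) :
    (-1 : ℂ) ^ (n / 2) * (-1) ^ ((n + 1) / 2) = (-1) ^ n := by
  rw [← pow_add]
  congr 1
  omega

/-- The factor relating `Qₙ²` to the Hankel determinant of size `n + 1`. -/
noncomputable def evenFactor (n : ℕ) : ℂ :=
  (-1) ^ ((n + 1) / 2) * 2 ^ n / factorialRatioProd n ^ 2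

/-- The factor relating `Qₙ₊₁ Qₙ` to the shifted Hankel determinant of size `n + 1`. -/
noncomputable def oddFactor (n : ℕ) : ℂ :=
  (-1) ^ ((n + 1) / 2) * 2 ^ (n + 1) / (factorialRatioProd (n + 1) * factorialRatioProd n)

lemma evenFactor_ne_zero (n : ℕ) : evenFactor n ≠ 0 := by
  exact div_ne_zero (mul_ne_zero (by simp) (by simp))
    (pow_ne_zero 2 (factorialRatioProd_ne_zero n))

lemma oddFactor_ne_zero (n : ℕ) : oddFactor n ≠ 0 := by
  exact div_ne_zero (mul_ne_zero (by simp) (by simp))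
    (mul_ne_zero (factorialRatioProd_ne_zero _) (factorialRatioProd_ne_zero n))

lemma neg_one_pow_sq (k : ℕ) : ((-1 : ℂ) ^ k) ^ 2 = 1 := by
  rw [← pow_mul, mul_comm, pow_mul]; simp

/-- With `oddFactor_mul_oddFactor`, the scalar counterpart of `intMoment_hankel_sq` and
`intMoment_hankel_toda`. -/
lemma oddFactor_sq (n : ℕ) :
    oddFactor n ^ 2 = 2 * (-1) ^ (n + 1) * evenFactor (n + 1) * evenFactor n := by
  have h1 := neg_one_pow_sq ((n + 1 + 1) / 2)
  unfold oddFactor evenFactor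
  rw [← neg_one_pow_half_mul_succ (n + 1)]
  generalize (-1 : ℂ) ^ ((n + 1) / 2) = s at *
  generalize (-1 : ℂ) ^ ((n + 1 + 1) / 2) = t at *
  linear_combination (-h1) * s ^ 2 * (2 ^ (n + 1)) ^ 2 /
    (factorialRatioProd (n + 1) * factorialRatioProd n) ^ 2

lemma oddFactor_mul_oddFactor (n : ℕ) :
    (2 * n + 3) * (oddFactor n * oddFactor (n + 1)) = (-1) ^ (n + 1) * evenFactor (n + 1) ^ 2 := by
  have h1 := neg_one_pow_sq ((n + 1 + 1) / 2)
  have h2 := factorialRatioProd_ne_zero (n + 1)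
  have h3 : (2 * n + 3 : ℂ) ≠ 0 := by exact_mod_cast Nat.succ_ne_zero (2 * n + 2)
  unfold oddFactor evenFactor
  rw [← neg_one_pow_half_mul_succ (n + 1)]
  generalize (-1 : ℂ) ^ ((n + 1) / 2) = s at *
  generalize (-1 : ℂ) ^ ((n + 1 + 1) / 2) = t at *
  rw [div_mul_div_comm, show factorialRatioProd (n + 1) * factorialRatioProd n *
    (factorialRatioProd (n + 1 + 1) * factorialRatioProd (n + 1)) =
    factorialRatioProd n * factorialRatioProd (n + 2) * factorialRatioProd (n + 1) ^ 2 by ring,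
    factorialRatioProd_mul]
  generalize factorialRatioProd (n + 1) = P at *
  have h4 : (2 * n + 3 : ℂ) * (s * 2 ^ (n + 1) * (t * 2 ^ (n + 1 + 1)) /
      (2 * (2 * n + 3) * P ^ 2 * P ^ 2)) = s * t * (2 ^ (n + 1)) ^ 2 / (P ^ 2) ^ 2 := by
    rw [mul_div_assoc', div_eq_div_iff (by simp [h2, h3]) (by simp [h2])]
    ring
  rw [h4]
  linear_combination (-h1) * s * t * (2 ^ (n + 1)) ^ 2 / (P ^ 2) ^ 2

lemma vorobevYablonski_add_two (n : ℕ) :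
    vorobevYablonski (n + 2) =
      recursionNumerator (vorobevYablonski (n + 1)) / vorobevYablonski n := by
  rw [vorobevYablonski, recursionNumerator]

/-- Exactness of the division must be carried along: the recursion at one stage is what identifies
the Hankel determinants of the next, and these prove the next division exact. -/
lemma hankelDet_intMoment_eq (n : ℕ) :
    vorobevYablonski n ≠ 0 ∧ vorobevYablonski (n + 1) ≠ 0 ∧
    hankelDet intMoment (n + 1) 0 = C (evenFactor n) * vorobevYablonski n ^ 2 ∧
    hankelDet intMoment (n + 2) 0 = C (evenFactor (n + 1)) * vorobevYablonski (n + 1) ^ 2 ∧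
    hankelDet intMoment (n + 1) 1 =
      C (oddFactor n) * (vorobevYablonski (n + 1) * vorobevYablonski n) ∧
    vorobevYablonski (n + 2) * vorobevYablonski n =
      recursionNumerator (vorobevYablonski (n + 1)) := by
  induction n with
  | zero =>
    have hV0 : vorobevYablonski 0 = 1 := by rw [vorobevYablonski]
    have hV1 : vorobevYablonski 1 = X := by rw [vorobevYablonski]
    have hP0 : factorialRatioProd 0 = 1 := by simp [factorialRatioProd]
    have hP1 : factorialRatioProd 1 = 2 := by simp [factorialRatioProd]
    have h1 : intMoment 1 = X := by
      have := intMoment_recurrence 1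
      rw [show (1 : ℤ) - 1 = 0 by ring, intMoment_zero, intMoment_of_neg (1 - 3) (by omega)] at this
      simpa using this
    have hb0 : hankelDet intMoment 1 0 = 1 := by
      simp [hankelDet, shiftDet, intMoment_zero]
    have ha1 : hankelDet intMoment 1 1 = X := by
      simp [hankelDet, shiftDet, h1]
    have hb1 := intMoment_hankel_sq 0
    refine ⟨?_, ?_, ?_, ?_, ?_, ?_⟩
    · rw [hV0]; exact one_ne_zero
    · rw [hV1]; exact X_ne_zero
    · rw [hV0, zero_add, hb0]
      simp [evenFactor, hP0]
    · rw [zero_add, hV1]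
      rw [zero_add, zero_add, hb0, ha1] at hb1
      simp only [evenFactor, zero_add, hP1]
      have : C ((-1 : ℂ) ^ ((1 + 1) / 2) * 2 ^ 1 / 2 ^ 2) * 2 = (-1 : ℂ[X]) := by
        rw [show (2 : ℂ[X]) = C 2 from (map_ofNat C 2).symm, ← C_mul]
        norm_num
      linear_combination (-C ((-1 : ℂ) ^ ((1 + 1) / 2) * 2 ^ 1 / 2 ^ 2)) * hb1 +
        hankelDet intMoment 2 0 * this
    · rw [zero_add, hV1, hV0, ha1]
      simp [oddFactor, hP0, hP1]
    · rw [vorobevYablonski_add_two, hV0, EuclideanDomain.div_one, mul_one]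
  | succ n ih =>
    obtain ⟨hu, hv, -, hb, ha, hrec⟩ := ih
    set u := vorobevYablonski n
    set v := vorobevYablonski (n + 1)
    set w := vorobevYablonski (n + 2)
    have hα := oddFactor_ne_zero n
    have hα' := oddFactor_ne_zero (n + 1)
    have hβ := evenFactor_ne_zero (n + 1)
    have hw : w ≠ 0 := by
      rintro h
      rw [h, zero_mul] at hrec
      exact recursionNumerator_ne_zero hv hrec.symm
    have ha' : hankelDet intMoment (n + 2) 1 = C (oddFactor (n + 1)) * (w * v) := by
      have h1 := intMoment_hankel_toda n
      rw [recursionNumerator_of_eq hb, ha, ← hrec] at h1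
      have h2 := congrArg C (oddFactor_mul_oddFactor n)
      simp only [C_mul, C_add, C_pow, C_neg, C_1, map_ofNat, map_natCast] at h2
      have h3 : (2 * (n : ℂ[X]) + 3) ≠ 0 := by exact_mod_cast Nat.succ_ne_zero (2 * n + 2)
      have h4 : (2 * (n : ℂ[X]) + 3) * C (oddFactor n) * (v * u) ≠ 0 :=
        mul_ne_zero (mul_ne_zero h3 (C_ne_zero.mpr hα)) (mul_ne_zero hv hu)
      refine mul_left_cancel₀ h4 ?_
      rw [C_pow] at h1
      linear_combination h1 - v ^ 2 * w * u * h2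
    have hb' : hankelDet intMoment (n + 3) 0 = C (evenFactor (n + 2)) * w ^ 2 := by
      have h1 := intMoment_hankel_sq (n + 1)
      rw [hb, ha'] at h1
      have h2 := congrArg C (oddFactor_sq (n + 1))
      simp only [C_mul, C_pow, C_neg, C_1, map_ofNat] at h2
      have h4 : (2 * (-1) ^ (n + 1 + 1) * C (evenFactor (n + 1)) * v ^ 2 : ℂ[X]) ≠ 0 :=
        mul_ne_zero (mul_ne_zero (by simp) (C_ne_zero.mpr hβ)) (pow_ne_zero 2 hv)
      refine mul_left_cancel₀ h4 ?_
      linear_combination -h1 + v ^ 2 * w ^ 2 * h2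
    refine ⟨hv, hw, hb, hb', ha', ?_⟩
    -- `w²` divides `b (n+2)`, hence `a (n+2) ^ 2`; as `ℂ[X]` is integrally closed, `w` divides `a
    -- (n+2)`.
    have hdvd : w ∣ hankelDet intMoment (n + 3) 1 := by
      have h1 := intMoment_hankel_sq (n + 2)
      rw [← IsIntegrallyClosed.pow_dvd_pow_iff (n := 2) two_ne_zero, h1, hb']
      exact ⟨2 * (-1) ^ (n + 2 + 1) * hankelDet intMoment (n + 2 + 2) 0 *
        C (evenFactor (n + 2)), by ring⟩
    obtain ⟨z, hz⟩ := hdvd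
    -- In the next Toda equation both sides contain `w²`; after cancelling it, the factor `v` of `a
    -- (n+1)` remains on the left.
    have hdvd' : v ∣ recursionNumerator w := by
      have h1 := intMoment_hankel_toda (n + 1)
      rw [recursionNumerator_of_eq hb', ha', hz] at h1
      have hγ : (-1 : ℂ) ^ (n + 1 + 1) * evenFactor (n + 2) ^ 2 ≠ 0 :=
        mul_ne_zero (by simp) (pow_ne_zero 2 (evenFactor_ne_zero _))
      have h2 : C ((-1 : ℂ) ^ (n + 1 + 1) * evenFactor (n + 2) ^ 2) * recursionNumerator w =
          v * ((2 * ((n + 1 : ℕ) : ℂ[X]) + 3) * C (oddFactor (n + 1)) * z) := by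
        refine mul_left_cancel₀ (pow_ne_zero 2 hw) ?_
        simp only [C_mul, C_pow, C_neg, C_1] at h1 ⊢
        linear_combination -h1
      exact (IsUnit.dvd_mul_left (isUnit_C.mpr (isUnit_iff_ne_zero.mpr hγ))).mp ⟨_, h2⟩
    rw [vorobevYablonski_add_two]
    rw [mul_comm]
    exact EuclideanDomain.mul_div_cancel' hv hdvd'

theorem theorem1 :
    IsVorobevYablonski vorobevYablonski ∧
    ∀ n : ℕ, 1 ≤ n →
      vorobevYablonski (n - 1) ^ 2 =
        C ((-1 : ℂ) ^ (n / 2) * (1 / 2 ^ (n - 1)) *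
            ∏ k ∈ Finset.Icc 1 (n - 1),
              (((2 * k).factorial : ℂ) / (k.factorial : ℂ)) ^ 2) *
          (Matrix.of fun l j : Fin n => moment ((l : ℕ) + (j : ℕ))).det := by
  refine ⟨⟨by rw [vorobevYablonski], by rw [vorobevYablonski], fun n hn => ?_⟩, fun n hn => ?_⟩
  · obtain ⟨m, rfl⟩ := Nat.exists_eq_add_of_le' hn
    exact (hankelDet_intMoment_eq m).2.2.2.2.2
  · obtain ⟨m, rfl⟩ := Nat.exists_eq_add_of_le' hn
    have h1 : (Matrix.of fun l j : Fin (m + 1) => moment ((l : ℕ) + (j : ℕ))).det =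
        hankelDet intMoment (m + 1) 0 := by
      unfold hankelDet shiftDet
      congr 1
      ext1 i j
      simp only [Matrix.of_apply]
      rw [← intMoment_natCast]
      push_cast
      rw [zero_add]
    rw [h1, (hankelDet_intMoment_eq m).2.2.1, ← mul_assoc, ← C_mul, Nat.add_sub_cancel,
      Finset.prod_pow]
    have h2 : (-1 : ℂ) ^ ((m + 1) / 2) * (1 / 2 ^ m) * (∏ k ∈ Finset.Icc 1 m,
        ((2 * k).factorial : ℂ) / (k.factorial : ℂ)) ^ 2 * evenFactor m = 1 := by
      have h3 := factorialRatioProd_ne_zero m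
      change _ * factorialRatioProd m ^ 2 * _ = _
      unfold evenFactor
      field_simp
      exact neg_one_pow_sq _
    rw [h2, C_1, one_mul]

end Induction
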